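/- Let $\epsilon\in\{1,-1\}$ and $n\ge 3$, and let $\mathbb{E}^{n+2}$ be $\mathbb{R}^{n+2}$ with the flat metric $\langle\,,\rangle=\epsilon\,dx_1^2+dx_2^2+\dots+dx_{n+2}^2$. Let $\mathbb{Q}^n_\epsilon\times\mathbb{R}\subset\mathbb{E}^{n+2}$ be the set of points with $\epsilon x_1^2+x_2^2+\dots+x_{n+1}^2=\epsilon$ (and $x_1>0$ if $\epsilon=-1$), so that $\mathbb{Q}^n_1=\mathbb{S}^n$ and $\mathbb{Q}^n_{-1}=\mathbb{H}^n$; let $\partial/\partial t$ be the unit vector along $x_{n+2}$, and let $\xi(p)=(p_1,\dots,p_{n+1},0)$ be the outward pointing unit normal of $\mathbb{Q}^n_\epsilon\times\mathbb{R}$ in $\mathbb{E}^{n+2}$. Let $f:M^n_0\to\mathbb{Q}^n_\epsilon\times\mathbb{R}$ be a hypersurface, that is, a smooth isometric immersion of an $n$-dimensional Riemannian manifold, where $M^n_0$ is flat (its sectional curvatures all vanish). For a unit normal vector $N$ to $f$ at a point $x$ (tangent to $\mathbb{Q}^n_\epsilon\times\mathbb{R}$), define $T\in T_xM$ and $\nu\in\mathbb{R}$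 by $\partial/\partial t=f_*T+\nu N$. For a vector $\eta$ normal to $f$ in $\mathbb{E}^{n+2}$ at $x$, let $A_\eta$ be the shape operator, $\langle A_\eta X,Y\rangle=\langle\alpha(X,Y),\eta\rangle$, where $\alpha$ is the second fundamental form of $f$ as an immersion into $\mathbb{E}^{n+2}$. Assume that $T\neq 0$ at $x\in M^n_0$. (i) If $\epsilon=1$, then $\nu$ vanishes at $x$. (ii) If $\epsilon=-1$, then either $\nu$ vanishes at $x$ or $A_N=A_\xi$ at $x$ for one of the two possible choices of a unit normal vector $N$ to $f$ at $x$. In any case, $T$ is a principal direction of $f$ at $x$, that is, an eigenvector of $A_N$. -/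

import Mathlib

open scoped Manifold ContDiff

noncomputable section

namespace ProductHypersurface

/-! ### The ambient space and the product of a space form with a line -/

/-- The vector space underlying `𝔼^{n+2}`; the index `0` is the coordinate `x₁` of signature `ε`
and the last index is the coordinate of the factor `ℝ`. -/
abbrev Ambient (n : ℕ) : Type := EuclideanSpace ℝ (Fin (n + 2))

/-- The flat metric `ε dx₁² + dx₂² + … + dx_{n+2}²` of `𝔼^{n+2}`. -/
def ambientForm {n : ℕ} (ε : ℝ) : LinearMap.BilinForm ℝ (Ambient n) :=
  LinearMap.mk₂ ℝ
    (fun x y => ε * (x 0 * y 0) + ∑ i : Fin (n + 1), x i.succ * y i.succ)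
    (fun x x' y => by
      simp only [PiLp.add_apply, add_mul, Finset.sum_add_distrib]; ring)
    (fun c x y => by
      simp only [PiLp.smul_apply, smul_eq_mul, mul_assoc, ← Finset.mul_sum]; ring)
    (fun x y y' => by
      simp only [PiLp.add_apply, mul_add, Finset.sum_add_distrib]; ring)
    (fun c x y => by
      simp only [PiLp.smul_apply, smul_eq_mul, mul_left_comm _ c, ← Finset.mul_sum]; ring)

/-- The subset `ℚ^n_ε × ℝ` of `𝔼^{n+2}`, for `ε = 1` (`𝕊^n × ℝ`) and `ε = -1` (`ℍ^n × ℝ`):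
`ε x₁² + x₂² + … + x_{n+1}² = ε`, with `x₁ > 0` if `ε = -1`; the last coordinate is free. -/
def productSpace (n : ℕ) (ε : ℝ) : Set (Ambient n) :=
  {p | ε * p 0 ^ 2 + ∑ i : Fin n, p i.castSucc.succ ^ 2 = ε ∧ (ε = -1 → 0 < p 0)}

/-- The unit vector `∂/∂t` tangent to the factor `ℝ`. -/
def verticalVector (n : ℕ) : Ambient n :=
  EuclideanSpace.single (Fin.last (n + 1)) 1

/-- The outward pointing unit normal `ξ` of `ℚ^n_ε × ℝ` in `𝔼^{n+2}` at the point `p`: the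
position vector of the component of `p` in `ℚ^n_ε`. -/
def outwardNormal {n : ℕ} (p : Ambient n) : Ambient n :=
  p - p (Fin.last (n + 1)) • verticalVector n

/-! ### Curvature of a Riemannian metric in coordinates -/

/-- Partial derivative `∂ᵢ φ` at `u` of a function of `n` real variables. -/
def partialDeriv {n : ℕ} (i : Fin n) (φ : EuclideanSpace ℝ (Fin n) → ℝ)
    (u : EuclideanSpace ℝ (Fin n)) : ℝ :=
  fderiv ℝ φ u (EuclideanSpace.single i 1)

/-- The Christoffel symbols
`Γ^k_{ij} = ½ ∑_l g^{kl} (∂ᵢ g_{jl} + ∂ⱼ g_{il} - ∂_l g_{ij})` of a metric `G = (g_{ij})` given in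
coordinates. -/
def christoffel {n : ℕ} (G : EuclideanSpace ℝ (Fin n) → Matrix (Fin n) (Fin n) ℝ)
    (k i j : Fin n) (u : EuclideanSpace ℝ (Fin n)) : ℝ :=
  (1 / 2) * ∑ l, (G u)⁻¹ k l *
    (partialDeriv i (fun z => G z j l) u + partialDeriv j (fun z => G z i l) u
      - partialDeriv l (fun z => G z i j) u)

/-- The components `R^l_{ijk}` of the curvature tensor of the Levi-Civita connection, where
`R(∂ᵢ, ∂ⱼ)∂ₖ = ∇_{∂ᵢ}∇_{∂ⱼ}∂ₖ - ∇_{∂ⱼ}∇_{∂ᵢ}∂ₖ = ∑_l R^l_{ijk} ∂_l`. -/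
def riemannComponent {n : ℕ} (G : EuclideanSpace ℝ (Fin n) → Matrix (Fin n) (Fin n) ℝ)
    (l i j k : Fin n) (u : EuclideanSpace ℝ (Fin n)) : ℝ :=
  partialDeriv i (christoffel G l j k) u - partialDeriv j (christoffel G l i k) u
    + ∑ m, (christoffel G l i m u * christoffel G m j k u
      - christoffel G l j m u * christoffel G m i k u)

section Manifold

variable {n : ℕ} {M : Type*} [TopologicalSpace M] [ChartedSpace (EuclideanSpace ℝ (Fin n)) M]
  [IsManifold (𝓡 n) ∞ M]

/-- A smooth Riemannian metric on the `n`-manifold `M`. -/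
abbrev Metric (n : ℕ) (M : Type*) [TopologicalSpace M]
    [ChartedSpace (EuclideanSpace ℝ (Fin n)) M] [IsManifold (𝓡 n) ∞ M] : Type _ :=
  Bundle.ContMDiffRiemannianMetric (𝓡 n) ∞ (EuclideanSpace ℝ (Fin n))
    (fun x : M => TangentSpace (𝓡 n) x)

/-- The components `g_{ij}` of the metric `g` in the preferred chart around `x`, as functions on
the image of that chart. -/
def metricInChart (g : Metric n M) (x : M) (u : EuclideanSpace ℝ (Fin n)) :
    Matrix (Fin n) (Fin n) ℝ :=
  Matrix.of fun i j => g.inner ((extChartAt (𝓡 n) x).symm u)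
    (mfderiv (𝓡 n) (𝓡 n) (extChartAt (𝓡 n) x).symm u (EuclideanSpace.single i (1 : ℝ)))
    (mfderiv (𝓡 n) (𝓡 n) (extChartAt (𝓡 n) x).symm u (EuclideanSpace.single j (1 : ℝ)))

/-- The components of a tangent vector at `x` in the preferred chart around `x`. In Mathlib the
tangent space at `x` is the model space, identified with it through the preferred chart. -/
def components (x : M) (v : TangentSpace (𝓡 n) x) (i : Fin n) : ℝ :=
  (show EuclideanSpace ℝ (Fin n) from v) i

/-- The curvature tensor `R(X, Y)Z` of `g` at `x`, computed in the preferred chart around `x`. -/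
def curvature (g : Metric n M) (x : M) (X Y Z : TangentSpace (𝓡 n) x) : TangentSpace (𝓡 n) x :=
  show EuclideanSpace ℝ (Fin n) from WithLp.toLp 2 fun l => ∑ i, ∑ j, ∑ k,
    components x X i * components x Y j * components x Z k *
      riemannComponent (metricInChart g x) l i j k (extChartAt (𝓡 n) x x)

/-- The sectional curvature of `g` at `x` along the plane spanned by two linearly independent
tangent vectors `X`, `Y`. -/
def sectionalCurvature (g : Metric n M) (x : M) (X Y : TangentSpace (𝓡 n) x) : ℝ :=
  g.inner x (curvature g x X Y Y) X / (g.inner x X X * g.inner x Y Y - g.inner x X Y ^ 2)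

/-- `(M, g)` has constant sectional curvature `c`. -/
def HasConstantSectionalCurvature (g : Metric n M) (c : ℝ) : Prop :=
  ∀ (x : M) (X Y : TangentSpace (𝓡 n) x), LinearIndependent ℝ ![X, Y] →
    sectionalCurvature g x X Y = c

/-- `(M, g)` is flat. -/
def IsFlat (g : Metric n M) : Prop := HasConstantSectionalCurvature g 0

/-! ### Hypersurfaces -/

/-- The differential of a map `f : M → 𝔼^{n+2}` at `x`. -/
def differential (f : M → Ambient n) (x : M) : TangentSpace (𝓡 n) x →ₗ[ℝ] Ambient n :=
  (mfderiv (𝓡 n) 𝓘(ℝ, Ambient n) f x).toLinearMap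

/-- `f` is a hypersurface of `ℚ^n_ε × ℝ`, that is, a smooth isometric immersion of the Riemannian
`n`-manifold `(M, g)` into `ℚ^n_ε × ℝ`, viewed in `𝔼^{n+2}`. -/
structure IsHypersurface (ε : ℝ) (g : Metric n M) (f : M → Ambient n) : Prop where
  smooth : ContMDiff (𝓡 n) 𝓘(ℝ, Ambient n) ∞ f
  mem : ∀ x, f x ∈ productSpace n ε
  isometric : ∀ (x : M) (v w : TangentSpace (𝓡 n) x),
    ambientForm ε (differential f x v) (differential f x w) = g.inner x v w

/-- `N` is a unit normal vector to the hypersurface `f` of `ℚ^n_ε × ℝ` at `x`: it is tangent to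
`ℚ^n_ε × ℝ`, orthogonal to `f_* T_x M`, and of length one. -/
structure IsUnitNormal (ε : ℝ) (f : M → Ambient n) (x : M) (N : Ambient n) : Prop where
  tangent : ambientForm ε N (outwardNormal (f x)) = 0
  normal : ∀ v : TangentSpace (𝓡 n) x, ambientForm ε N (differential f x v) = 0
  unit : ambientForm ε N N = 1

/-- The metric at `x` as a bilinear form. -/
def metricForm (g : Metric n M) (x : M) : LinearMap.BilinForm ℝ (TangentSpace (𝓡 n) x) :=
  LinearMap.mk₂ ℝ (fun v w => g.inner x v w) (by simp) (by simp) (by simp) (by simp)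

lemma metricForm_nondegenerate (g : Metric n M) (x : M) : (metricForm g x).Nondegenerate := by
  refine ⟨fun v hv => ?_, fun v hv => ?_⟩ <;>
  · by_contra h
    exact (g.pos x v h).ne' (hv v)

/-- The tangent vector at `x` which represents a linear functional through the metric. -/
def sharp (g : Metric n M) (x : M) :
    Module.Dual ℝ (TangentSpace (𝓡 n) x) →ₗ[ℝ] TangentSpace (𝓡 n) x :=
  haveI : FiniteDimensional ℝ (TangentSpace (𝓡 n) x) :=
    inferInstanceAs (FiniteDimensional ℝ (EuclideanSpace ℝ (Fin n)))
  ((metricForm g x).toDual (metricForm_nondegenerate g x)).symm.toLinearMap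

lemma inner_sharp (g : Metric n M) (x : M) (φ : Module.Dual ℝ (TangentSpace (𝓡 n) x))
    (w : TangentSpace (𝓡 n) x) : g.inner x (sharp g x φ) w = φ w := by
  have : FiniteDimensional ℝ (TangentSpace (𝓡 n) x) :=
    inferInstanceAs (FiniteDimensional ℝ (EuclideanSpace ℝ (Fin n)))
  exact LinearMap.BilinForm.apply_toDual_symm_apply (B := metricForm g x) φ w

/-- The vector `T` at `x`: the tangential component of `∂/∂t`, that is, the vector `T` of `T_x M`
with `⟨T, w⟩ = ⟨∂/∂t, f_* w⟩` for all `w`. -/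
def tangentComponent (ε : ℝ) (g : Metric n M) (f : M → Ambient n) (x : M) :
    TangentSpace (𝓡 n) x :=
  sharp g x ((ambientForm ε (verticalVector n)).comp (differential f x))

/-- The number `ν`: the component of `∂/∂t` along the unit normal vector `N`. -/
def normalComponent {n : ℕ} (ε : ℝ) (N : Ambient n) : ℝ :=
  ambientForm ε (verticalVector n) N

/-- The second derivative at `x` of `f` in the preferred chart around `x`. Its value at `(v, w)` is
the derivative, in the flat space `𝔼^{n+2}` and in the direction `v`, of `f_* W`, where `W` is the
field with constant components in the chart that extends `w`. -/
def secondDerivative (f : M → Ambient n) (x : M) (v w : TangentSpace (𝓡 n) x) : Ambient n :=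
  fderiv ℝ (fderiv ℝ (f ∘ (extChartAt (𝓡 n) x).symm)) (extChartAt (𝓡 n) x x)
    (show EuclideanSpace ℝ (Fin n) from v) (show EuclideanSpace ℝ (Fin n) from w)

/-- The component `w ↦ ⟨α(v, w), η⟩` of the second fundamental form `α` of `f` along the normal
vector `η`. Since `η` is normal, only the normal part `α(v, w)` of the second derivative of `f`
contributes; for `η` tangent to `ℚ^n_ε × ℝ` this is therefore also the component along `η` of the
second fundamental form of `f` as a hypersurface of `ℚ^n_ε × ℝ`. -/
def secondFundamentalForm (ε : ℝ) (f : M → Ambient n) (x : M) (η : Ambient n) :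
    TangentSpace (𝓡 n) x →ₗ[ℝ] Module.Dual ℝ (TangentSpace (𝓡 n) x) :=
  have h₁ (L : EuclideanSpace ℝ (Fin n) →L[ℝ] EuclideanSpace ℝ (Fin n) →L[ℝ] Ambient n)
      (v v' w) : ambientForm ε η (L (v + v') w) =
        ambientForm ε η (L v w) + ambientForm ε η (L v' w) := by simp
  have h₂ (L : EuclideanSpace ℝ (Fin n) →L[ℝ] EuclideanSpace ℝ (Fin n) →L[ℝ] Ambient n)
      (c : ℝ) (v w) : ambientForm ε η (L (c • v) w) = c • ambientForm ε η (L v w) := by simp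
  have h₃ (L : EuclideanSpace ℝ (Fin n) →L[ℝ] EuclideanSpace ℝ (Fin n) →L[ℝ] Ambient n)
      (v w w') : ambientForm ε η (L v (w + w')) =
        ambientForm ε η (L v w) + ambientForm ε η (L v w') := by simp
  have h₄ (L : EuclideanSpace ℝ (Fin n) →L[ℝ] EuclideanSpace ℝ (Fin n) →L[ℝ] Ambient n)
      (c : ℝ) (v w) : ambientForm ε η (L v (c • w)) = c • ambientForm ε η (L v w) := by simp
  LinearMap.mk₂ ℝ (fun v w => ambientForm ε η (secondDerivative f x v w))
    (fun _ _ _ => h₁ _ _ _ _) (fun _ _ _ => h₂ _ _ _ _)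
    (fun _ _ _ => h₃ _ _ _ _) (fun _ _ _ => h₄ _ _ _ _)

/-- The shape operator `A_η` of `f` at `x` with respect to the normal vector `η`, given by
`⟨A_η v, w⟩ = ⟨α(v, w), η⟩`. -/
def shapeOperator (ε : ℝ) (g : Metric n M) (f : M → Ambient n) (x : M) (η : Ambient n) :
    TangentSpace (𝓡 n) x →ₗ[ℝ] TangentSpace (𝓡 n) x :=
  sharp g x ∘ₗ secondFundamentalForm ε f x η

/-- `v` is a principal direction at `x` of the hypersurface with unit normal vector `N`: a nonzero
eigenvector of the shape operator `A_N`. -/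
def IsPrincipalDirection (ε : ℝ) (g : Metric n M) (f : M → Ambient n) (x : M) (N : Ambient n)
    (v : TangentSpace (𝓡 n) x) : Prop :=
  ∃ μ : ℝ, Module.End.HasEigenvector (shapeOperator ε g f x N) μ v

end Manifold

end ProductHypersurface

end

set_option linter.unusedSectionVars false

noncomputable section

namespace ProductHypersurface

/-! ### The Gauss equation in coordinates -/

section Gauss

variable {n : ℕ} {W : Type*} [NormedAddCommGroup W] [NormedSpace ℝ W]

/-! View `f` in flat `𝔼^{n+2}`, where its normal space at `x` is spanned by `N` and `ξ`, with `⟨N,N⟩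
= 1` and `⟨ξ,ξ⟩ = ε`. Write `a = ⟨A_N ·,·⟩` and `h = -⟨A_ξ ·,·⟩`. When the metric is flat, the Gauss
equation says that the exterior squares satisfy `a ∧ a = -ε h ∧ h` (`gauss_equation`,
`wedge_secondFundamentalForm`). Differentiating the equation of the quadric twice gives `h = ⟨·,·⟩ -
⟨T,·⟩⟨T,·⟩` (`secondFundamentalForm_outwardNormal`), and `|T|² + ν² = 1`.

If `ν ≠ 0`, then `|T| < 1`, so `h` is positive definite. In dimension at least three this forces `a
= r h` with `r² = -ε` (`exists_eq_smul_of_wedge_eq`): impossible for `ε = 1`, while for `ε = -1` it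
gives `A_N = ±A_ξ`. Since `h(T,·) = (1 - |T|²)⟨T,·⟩`, `T` is an eigenvector of `A_N`.

If `ν = 0`, then `|T| = 1` and `T` lies in the radical of `h`. As `h` is definite on the complement
of `T`, of dimension at least two, `h ∧ h ≠ 0`, and `T` must also lie in the radical of `a`
(`apply_eq_zero_of_wedge_eq`), so `A_N T = 0`. -/

lemma partialDeriv_bilin (B : W →L[ℝ] W →L[ℝ] ℝ) {p q : EuclideanSpace ℝ (Fin n) → W}
    {u : EuclideanSpace ℝ (Fin n)} (hp : DifferentiableAt ℝ p u) (hq : DifferentiableAt ℝ q u)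
    (i : Fin n) :
    partialDeriv i (fun z => B (p z) (q z)) u =
      B (fderiv ℝ p u (EuclideanSpace.single i 1)) (q u) +
        B (p u) (fderiv ℝ q u (EuclideanSpace.single i 1)) := by
  have h := (B.hasFDerivAt_of_bilinear hp.hasFDerivAt hq.hasFDerivAt).fderiv
  rw [partialDeriv, h]
  simp [add_comm]

lemma partialDeriv_sum_mul {ι : Type*} [Fintype ι] {p q : ι → EuclideanSpace ℝ (Fin n) → ℝ}
    {u : EuclideanSpace ℝ (Fin n)} (hp : ∀ k, DifferentiableAt ℝ (p k) u)
    (hq : ∀ k, DifferentiableAt ℝ (q k) u) (i : Fin n) :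
    partialDeriv i (fun z => ∑ k, p k z * q k z) u =
      ∑ k, (partialDeriv i (p k) u * q k u + p k u * partialDeriv i (q k) u) := by
  have h : HasFDerivAt (fun z => ∑ k, p k z * q k z) _ u :=
    HasFDerivAt.fun_sum fun k _ => (hp k).hasFDerivAt.mul (hq k).hasFDerivAt
  rw [partialDeriv, h.fderiv]
  simp [partialDeriv, add_comm, mul_comm]

lemma partialDeriv_congr {φ ψ : EuclideanSpace ℝ (Fin n) → ℝ} {u : EuclideanSpace ℝ (Fin n)}
    (h : φ =ᶠ[nhds u] ψ) (i : Fin n) : partialDeriv i φ u = partialDeriv i ψ u := by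
  rw [partialDeriv, partialDeriv, h.fderiv_eq]

lemma differentiableAt_det {E : Type*} [NormedAddCommGroup E] [NormedSpace ℝ E]
    {G : E → Matrix (Fin n) (Fin n) ℝ} {u : E}
    (hG : ∀ i j, DifferentiableAt ℝ (fun z => G z i j) u) :
    DifferentiableAt ℝ (fun z => (G z).det) u := by
  simp only [Matrix.det_apply]
  refine DifferentiableAt.fun_sum fun σ _ => ?_
  refine DifferentiableAt.const_smul ?_ (Equiv.Perm.sign σ)
  have h := (HasFDerivAt.finsetProd (u := Finset.univ) fun i _ =>
    (hG (σ i) i).hasFDerivAt).differentiableAt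
  exact h

lemma differentiableAt_inv_apply {E : Type*} [NormedAddCommGroup E] [NormedSpace ℝ E]
    {G : E → Matrix (Fin n) (Fin n) ℝ} {u : E}
    (hG : ∀ i j, DifferentiableAt ℝ (fun z => G z i j) u) (hdet : (G u).det ≠ 0) (i j : Fin n) :
    DifferentiableAt ℝ (fun z => (G z)⁻¹ i j) u := by
  simp only [Matrix.inv_def, Ring.inverse_eq_inv', Matrix.smul_apply, smul_eq_mul,
    Matrix.adjugate_apply]
  -- Cramer's rule: an entry of the adjugate is the determinant of `G` with one row replaced by a
  -- constant row.
  refine ((differentiableAt_det hG).inv hdet).mul (differentiableAt_det fun k l => ?_)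
  by_cases h : k = j
  · subst h; simp
  · simpa [Matrix.updateRow_ne h] using hG k l

/-- Partial derivative of a vector-valued map along a basis vector. -/
abbrev coordDeriv (F : EuclideanSpace ℝ (Fin n) → W) (i : Fin n)
    (u : EuclideanSpace ℝ (Fin n)) : W :=
  fderiv ℝ F u (EuclideanSpace.single i 1)

/-- Second partial derivative of a vector-valued map along basis vectors. -/
abbrev coordDeriv₂ (F : EuclideanSpace ℝ (Fin n) → W) (i j : Fin n)
    (u : EuclideanSpace ℝ (Fin n)) : W :=
  fderiv ℝ (fderiv ℝ F) u (EuclideanSpace.single i 1) (EuclideanSpace.single j 1)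

variable {F : EuclideanSpace ℝ (Fin n) → W} {u : EuclideanSpace ℝ (Fin n)}

lemma contDiffAt_fderiv {V : Type*} [NormedAddCommGroup V] [NormedSpace ℝ V]
    {φ : EuclideanSpace ℝ (Fin n) → V} (h : ContDiffAt ℝ ∞ φ u) :
    ContDiffAt ℝ ∞ (fderiv ℝ φ) u :=
  h.fderiv_right (m := ∞) (by simp)

lemma hasFDerivAt_coordDeriv (hF : ContDiffAt ℝ ∞ F u) (j : Fin n) :
    DifferentiableAt ℝ (coordDeriv F j) u ∧
      ∀ i, fderiv ℝ (coordDeriv F j) u (EuclideanSpace.single i 1) = coordDeriv₂ F i j u := by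
  have h : DifferentiableAt ℝ (fderiv ℝ F) u := (contDiffAt_fderiv hF).differentiableAt (by simp)
  have h' := h.hasFDerivAt.clm_apply (hasFDerivAt_const (EuclideanSpace.single j (1 : ℝ)) u)
  refine ⟨h'.differentiableAt, fun i => ?_⟩
  refine (DFunLike.congr_fun h'.fderiv _).trans ?_
  simp

lemma two_le_infty : minSmoothness ℝ 2 ≤ (∞ : WithTop ℕ∞) := by
  simpa using (WithTop.coe_le_coe.2 le_top : ((2 : ℕ∞) : WithTop ℕ∞) ≤ ((⊤ : ℕ∞) : WithTop ℕ∞))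

lemma coordDeriv₂_symm (hF : ContDiffAt ℝ ∞ F u) (v w : EuclideanSpace ℝ (Fin n)) :
    fderiv ℝ (fderiv ℝ F) u v w = fderiv ℝ (fderiv ℝ F) u w v :=
  (hF.isSymmSndFDerivAt two_le_infty) v w

lemma differentiableAt_coordDeriv₂ (hF : ContDiffAt ℝ ∞ F u) (j k : Fin n) :
    DifferentiableAt ℝ (coordDeriv₂ F j k) u := by
  have h : DifferentiableAt ℝ (fderiv ℝ (fderiv ℝ F)) u :=
    (contDiffAt_fderiv (contDiffAt_fderiv hF)).differentiableAt (by simp)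
  unfold coordDeriv₂
  fun_prop

/-- Schwarz's theorem for `fderiv ℝ F`; it makes the third derivatives cancel in the curvature. -/
lemma fderiv_coordDeriv₂_symm (hF : ContDiffAt ℝ ∞ F u) (i j k : Fin n) :
    fderiv ℝ (coordDeriv₂ F j k) u (EuclideanSpace.single i 1) =
      fderiv ℝ (coordDeriv₂ F i k) u (EuclideanSpace.single j 1) := by
  have h : DifferentiableAt ℝ (fderiv ℝ (fderiv ℝ F)) u :=
    (contDiffAt_fderiv (contDiffAt_fderiv hF)).differentiableAt (by simp)
  have key (v w : EuclideanSpace ℝ (Fin n)) (a : EuclideanSpace ℝ (Fin n)) :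
      fderiv ℝ (fun z => fderiv ℝ (fderiv ℝ F) z v w) u a =
        fderiv ℝ (fderiv ℝ (fderiv ℝ F)) u a v w := by
    have h' := (h.hasFDerivAt.clm_apply (hasFDerivAt_const v u)).clm_apply (hasFDerivAt_const w u)
    rw [h'.fderiv]
    simp
  refine (key _ _ _).trans (Eq.trans ?_ (key _ _ _).symm)
  rw [
    ((contDiffAt_fderiv hF).isSymmSndFDerivAt two_le_infty) (EuclideanSpace.single i 1)]

variable {G : EuclideanSpace ℝ (Fin n) → Matrix (Fin n) (Fin n) ℝ} {B : W →L[ℝ] W →L[ℝ] ℝ}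

lemma partialDeriv_metric (hF : ContDiffAt ℝ ∞ F u)
    (hG : ∀ᶠ z in nhds u, ∀ i j, G z i j = B (coordDeriv F i z) (coordDeriv F j z))
    (i j k : Fin n) :
    partialDeriv i (fun z => G z j k) u =
      B (coordDeriv₂ F i j u) (coordDeriv F k u) + B (coordDeriv F j u) (coordDeriv₂ F i k u) := by
  rw [partialDeriv_congr (hG.mono fun z hz => hz j k),
    partialDeriv_bilin B (hasFDerivAt_coordDeriv hF j).1 (hasFDerivAt_coordDeriv hF k).1,
    (hasFDerivAt_coordDeriv hF j).2, (hasFDerivAt_coordDeriv hF k).2]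

/-- Expanding the three derivatives of the metric gives six products; by symmetry of second
derivatives four cancel and the other two coincide. -/
lemma christoffel_eq (hB : ∀ v w, B v w = B w v) (hF : ContDiffAt ℝ ∞ F u)
    (hG : ∀ᶠ z in nhds u, ∀ i j, G z i j = B (coordDeriv F i z) (coordDeriv F j z))
    (k i j : Fin n) :
    christoffel G k i j u = ∑ l, (G u)⁻¹ k l * B (coordDeriv₂ F i j u) (coordDeriv F l u) := by
  rw [christoffel, Finset.mul_sum]
  refine Finset.sum_congr rfl fun l _ => ?_
  simp only [partialDeriv_metric hF hG]
  rw [hB (coordDeriv F j u), hB (coordDeriv F i u), hB (coordDeriv F i u)]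
  simp only [coordDeriv₂]
  rw [coordDeriv₂_symm hF (EuclideanSpace.single i 1) (EuclideanSpace.single l 1),
    coordDeriv₂_symm hF (EuclideanSpace.single j 1) (EuclideanSpace.single l 1),
    coordDeriv₂_symm hF (EuclideanSpace.single j 1) (EuclideanSpace.single i 1)]
  ring

/-- Lowering the index removes the inverse matrix, so that the curvature can be computed by
differentiating this identity rather than `G⁻¹`. -/
lemma sum_christoffel_mul (hB : ∀ v w, B v w = B w v) (hF : ContDiffAt ℝ ∞ F u)
    (hG : ∀ᶠ z in nhds u, ∀ i j, G z i j = B (coordDeriv F i z) (coordDeriv F j z))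
    (hdet : (G u).det ≠ 0) (i j m : Fin n) :
    ∑ k, christoffel G k i j u * G u k m = B (coordDeriv₂ F i j u) (coordDeriv F m u) := by
  have hinv : G u * (G u)⁻¹ = 1 := Matrix.mul_nonsing_inv _ (isUnit_iff_ne_zero.2 hdet)
  have hsymm (k l : Fin n) : G u k l = G u l k := by
    rw [hG.self_of_nhds, hG.self_of_nhds, hB]
  simp only [christoffel_eq hB hF hG, Finset.sum_mul]
  rw [Finset.sum_comm]
  have (l : Fin n) : ∑ k, (G u)⁻¹ k l * B (coordDeriv₂ F i j u) (coordDeriv F l u) * G u k m =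
      (G u * (G u)⁻¹) m l * B (coordDeriv₂ F i j u) (coordDeriv F l u) := by
    rw [Matrix.mul_apply, Finset.sum_mul]
    exact Finset.sum_congr rfl fun k _ => by rw [hsymm k m]; ring
  simp [this, hinv, Matrix.one_apply]

lemma differentiableAt_metric (hF : ContDiffAt ℝ ∞ F u)
    (hG : ∀ᶠ z in nhds u, ∀ i j, G z i j = B (coordDeriv F i z) (coordDeriv F j z))
    (i j : Fin n) : DifferentiableAt ℝ (fun z => G z i j) u := by
  have h : DifferentiableAt ℝ (fun z => B (coordDeriv F i z) (coordDeriv F j z)) u :=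
    (B.hasFDerivAt_of_bilinear (hasFDerivAt_coordDeriv hF i).1.hasFDerivAt
      (hasFDerivAt_coordDeriv hF j).1.hasFDerivAt).differentiableAt
  exact h.congr_of_eventuallyEq (hG.mono fun z hz => hz i j)

/-- The closed formula of `christoffel_eq` holds on a neighbourhood of `u`, and each of its factors
is differentiable at `u`. -/
lemma differentiableAt_christoffel (hB : ∀ v w, B v w = B w v)
    (hF : ∀ᶠ z in nhds u, ContDiffAt ℝ ∞ F z)
    (hG : ∀ᶠ z in nhds u, ∀ i j, G z i j = B (coordDeriv F i z) (coordDeriv F j z))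
    (hdet : (G u).det ≠ 0) (k i j : Fin n) :
    DifferentiableAt ℝ (christoffel G k i j) u := by
  have h : DifferentiableAt ℝ
      (fun z => ∑ l, (G z)⁻¹ k l * B (coordDeriv₂ F i j z) (coordDeriv F l z)) u := by
    refine DifferentiableAt.fun_sum fun l _ => ?_
    refine (differentiableAt_inv_apply (differentiableAt_metric hF.self_of_nhds hG) hdet k l).mul ?_
    exact (B.hasFDerivAt_of_bilinear
      (differentiableAt_coordDeriv₂ hF.self_of_nhds i j).hasFDerivAt
      (hasFDerivAt_coordDeriv hF.self_of_nhds l).1.hasFDerivAt).differentiableAt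
  refine h.congr_of_eventuallyEq ?_
  filter_upwards [hF, hG.eventually_nhds] with z hz hz'
  exact christoffel_eq hB hz hz' k i j

/-- The Gauss equation in coordinates: the curvature tensor of the metric induced on the domain of
a map into a flat space, in terms of the second derivatives of the map. -/
theorem gauss_equation_coord (hB : ∀ v w, B v w = B w v)
    (hF : ∀ᶠ z in nhds u, ContDiffAt ℝ ∞ F z)
    (hG : ∀ᶠ z in nhds u, ∀ i j, G z i j = B (coordDeriv F i z) (coordDeriv F j z))
    (hdet : (G u).det ≠ 0) (i j k m : Fin n) :
    ∑ l, riemannComponent G l i j k u * G u l m =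
      (B (coordDeriv₂ F j k u) (coordDeriv₂ F i m u)
        - ∑ l, christoffel G l j k u * B (coordDeriv F l u) (coordDeriv₂ F i m u))
      - (B (coordDeriv₂ F i k u) (coordDeriv₂ F j m u)
        - ∑ l, christoffel G l i k u * B (coordDeriv F l u) (coordDeriv₂ F j m u)) := by
  have hFu := hF.self_of_nhds
  have hdet' : ∀ᶠ z in nhds u, (G z).det ≠ 0 :=
    (differentiableAt_det (differentiableAt_metric hFu hG)).continuousAt.eventually_ne hdet
  have hderiv (i j k : Fin n) :
      ∑ l, partialDeriv i (christoffel G l j k) u * G u l m =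
        B (fderiv ℝ (coordDeriv₂ F j k) u (EuclideanSpace.single i 1)) (coordDeriv F m u)
          + B (coordDeriv₂ F j k u) (coordDeriv₂ F i m u)
          - ∑ l, christoffel G l j k u * B (coordDeriv₂ F i l u) (coordDeriv F m u)
          - ∑ l, christoffel G l j k u * B (coordDeriv F l u) (coordDeriv₂ F i m u) := by
    -- The lowered identity holds near `u`, where the determinant stays nonzero, so both sides may
    -- be differentiated.
    have h₁ : (fun z => ∑ l, christoffel G l j k z * G z l m) =ᶠ[nhds u]
        fun z => B (coordDeriv₂ F j k z) (coordDeriv F m z) := by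
      filter_upwards [hF, hG.eventually_nhds, hdet'] with z h₁ h₂ h₃
      exact sum_christoffel_mul hB h₁ h₂ h₃ j k m
    have h₂ := partialDeriv_congr h₁ i
    rw [partialDeriv_sum_mul (fun l => differentiableAt_christoffel hB hF hG hdet l j k)
      (fun l => differentiableAt_metric hFu hG l m),
      partialDeriv_bilin B (differentiableAt_coordDeriv₂ hFu j k) (hasFDerivAt_coordDeriv hFu m).1,
      (hasFDerivAt_coordDeriv hFu m).2, Finset.sum_add_distrib] at h₂
    simp only [partialDeriv_metric hFu hG, mul_add, Finset.sum_add_distrib] at h₂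
    linarith
  -- The quadratic Christoffel terms of the curvature cancel the sums of `⟨F_il, F_m⟩` in `hderiv`.
  have hquad (i j : Fin n) :
      ∑ l, (∑ p, christoffel G l i p u * christoffel G p j k u) * G u l m =
        ∑ p, christoffel G p j k u * B (coordDeriv₂ F i p u) (coordDeriv F m u) := by
    simp only [Finset.sum_mul]
    rw [Finset.sum_comm]
    refine Finset.sum_congr rfl fun p _ => ?_
    rw [← sum_christoffel_mul hB hFu hG hdet i p m, Finset.mul_sum]
    exact Finset.sum_congr rfl fun l _ => by ring
  have hsplit : ∑ l, riemannComponent G l i j k u * G u l m =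
      ∑ l, partialDeriv i (christoffel G l j k) u * G u l m
        - ∑ l, partialDeriv j (christoffel G l i k) u * G u l m
        + (∑ l, (∑ p, christoffel G l i p u * christoffel G p j k u) * G u l m
          - ∑ l, (∑ p, christoffel G l j p u * christoffel G p i k u) * G u l m) := by
    simp only [← Finset.sum_sub_distrib, ← Finset.sum_add_distrib, riemannComponent]
    refine Finset.sum_congr rfl fun l _ => ?_
    rw [Finset.sum_sub_distrib]
    ring
  rw [hsplit, hderiv, hderiv, hquad, hquad, fderiv_coordDeriv₂_symm hFu i j k]
  ring

end Gauss

/-! ### Symmetric bilinear forms with proportional exterior squares -/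

section Forms

variable {V : Type*} [AddCommGroup V] [Module ℝ V]

lemma exists_ne_zero_apply_eq_zero₂ [FiniteDimensional ℝ V] (hV : 3 ≤ Module.finrank ℝ V)
    (φ ψ : Module.Dual ℝ V) : ∃ z, z ≠ 0 ∧ φ z = 0 ∧ ψ z = 0 := by
  have h : LinearMap.ker (φ.prod ψ) ≠ ⊥ :=
    LinearMap.ker_ne_bot_of_finrank_lt (by simp; omega)
  obtain ⟨z, hz, hz'⟩ := (Submodule.ne_bot_iff _).1 h
  simp only [LinearMap.mem_ker, LinearMap.prod_apply, Function.prod_apply, Prod.mk_eq_zero] at hz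
  exact ⟨z, hz', hz.1, hz.2⟩

variable {a h : V →ₗ[ℝ] Module.Dual ℝ V} {c : ℝ}

/-- The identity of exterior squares on a plane implies the identity of the corresponding
curvature-like tensors. -/
lemma wedge_eq_of_diagonal (ha : ∀ v w, a v w = a w v) (hh : ∀ v w, h v w = h w v)
    (hdiag : ∀ v w, a v v * a w w - a v w ^ 2 = c * (h v v * h w w - h v w ^ 2))
    (x y z w : V) :
    a x w * a y z - a x z * a y w = c * (h x w * h y z - h x z * h y w) := by
  have semi (x y z : V) :
      a x x * a y z - a x z * a y x = c * (h x x * h y z - h x z * h y x) := by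
    have h₁ := hdiag x (y + z)
    have h₂ := hdiag x y
    have h₃ := hdiag x z
    simp only [map_add, LinearMap.add_apply] at h₁
    rw [ha z y, hh z y] at h₁
    rw [ha y x, hh y x]
    linear_combination (h₁ - h₂ - h₃) / 2
  have pol (x y z w : V) : a x w * a y z + a w x * a y z - a x z * a y w - a w z * a y x =
      c * (h x w * h y z + h w x * h y z - h x z * h y w - h w z * h y x) := by
    have h₁ := semi (x + w) y z
    have h₂ := semi x y z
    have h₃ := semi w y z
    simp only [map_add, LinearMap.add_apply] at h₁
    linear_combination h₁ - h₂ - h₃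
  -- The difference of the two sides is a curvature-like tensor, and `pol` makes it skew under `x ↔
  -- w` as well; the first Bianchi identity then gives three times it equal to zero.
  have h₁ := pol x y z w
  have h₂ := pol x z y w
  have h₃ := pol y x z w
  simp only [ha w, hh w, ha z x, ha z y, ha y x, hh z x, hh z y, hh y x] at h₁ h₂ h₃ ⊢
  linear_combination (h₁ - h₃) / 3

/-- If `a ∧ a = c h ∧ h` is nonzero and `t` is in the radical of `h`, it is in that of `a`. -/
theorem apply_eq_zero_of_wedge_eq (hc : c ≠ 0)
    (hw : ∀ x y z w, a x w * a y z - a x z * a y w = c * (h x w * h y z - h x z * h y w))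
    {t : V} (ht : h t = 0) {x y : V} (hxy : h x x * h y y - h x y * h y x ≠ 0) : a t = 0 := by
  by_contra h0
  obtain ⟨w, hw'⟩ : ∃ w, a t w ≠ 0 := by
    by_contra! h1
    exact h0 (LinearMap.ext h1)
  have e (y z : V) : a t w * a y z = a t z * a y w := by
    have := hw t y z w
    simp only [ht, LinearMap.zero_apply, zero_mul, sub_zero, mul_zero] at this
    linarith
  have h₁ := hw x y y x
  have h₂ : a t w ^ 2 * (a x x * a y y - a x y * a y x) = 0 := by
    linear_combination (a t w * a y y) * e x x + a t x * a x w * e y y -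
      a t w * a y x * e x y - a t y * a x w * e y x
  rw [h₁] at h₂
  exact mul_ne_zero (pow_ne_zero 2 hw') (mul_ne_zero hc hxy) h₂

variable [FiniteDimensional ℝ V]

/-- If `a ∧ a = c h ∧ h` with `h` positive definite in dimension at least three and `c ≠ 0`, then
`a` is a multiple of `h`. -/
theorem exists_eq_smul_of_wedge_eq (hV : 3 ≤ Module.finrank ℝ V) (hc : c ≠ 0)
    (ha : ∀ v w, a v w = a w v) (hh : ∀ v w, h v w = h w v) (hpos : ∀ v, v ≠ 0 → 0 < h v v)
    (hw : ∀ x y z w, a x w * a y z - a x z * a y w = c * (h x w * h y z - h x z * h y w)) :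
    ∃ r : ℝ, r ^ 2 = c ∧ a = r • h := by
  have orth (x y : V) (hx : x ≠ 0) (hy : y ≠ 0) (hxy : h x y = 0) :
      a x y = 0 ∧ a x x ^ 2 = c * h x x ^ 2 ∧ a x x * a y y = c * (h x x * h y y) := by
    obtain ⟨z, hz, hxz, hyz⟩ := exists_ne_zero_apply_eq_zero₂ hV (h x) (h y)
    have px := hpos x hx
    have py := hpos y hy
    have pz := hpos z hz
    -- On an `h`-orthogonal triple, the `2 × 2` minors of `a` agree with those of a diagonal matrix.
    -- The relations used here express `a x y` times a nonzero principal minor through vanishing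
    -- minors.
    have off {x y z : V} (pz : 0 < h z z) (px : 0 < h x x) (hxy : h x y = 0) (hxz : h x z = 0)
        (hyz : h y z = 0) : a x y = 0 := by
      have e₁ := hw x z z x
      have e₂ := hw x y z x
      have e₄ := hw x z z y
      simp only [hh z x, hh z y, hh y x, ha z x, ha z y, ha y x, hxy, hxz, hyz] at e₁ e₂ e₄
      have : c * (h x x * h z z) * a x y = 0 := by
        linear_combination (-a x y) * e₁ + a x x * e₄ + a x z * e₂
      have h0 : c * (h x x * h z z) ≠ 0 := mul_ne_zero hc (mul_pos px pz).ne'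
      exact (mul_eq_zero.1 this).resolve_left h0
    have s := off pz px hxy hxz hyz
    have t := off py px hxz hxy (by rw [hh, hyz])
    have u := off px py hyz (by rw [hh, hxy]) (by rw [hh, hxz])
    have e₁ := hw x y y x
    have e₂ := hw x z z x
    have e₃ := hw y z z y
    simp only [hxy, hxz, hyz, s, t, u, zero_mul, sub_zero] at e₁ e₂ e₃
    refine ⟨s, ?_, e₁⟩
    -- All three products of two diagonal entries are known; the product of the `xy` and `xz` ones
    -- divided by the `yz` one isolates `a x x ^ 2`. This is where the third dimension enters.
    have h0 : c * (h y y * h z z) ≠ 0 := mul_ne_zero hc (mul_pos py pz).ne'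
    refine mul_right_cancel₀ h0 ?_
    linear_combination (-a x x ^ 2) * e₃ + a x x * a z z * e₁ + c * (h x x * h y y) * e₂
  have : Nontrivial V := Module.nontrivial_of_finrank_pos (R := ℝ) (by omega)
  obtain ⟨x, hx⟩ := exists_ne (0 : V)
  have px := (hpos x hx).ne'
  obtain ⟨y, hy, hxy, -⟩ := exists_ne_zero_apply_eq_zero₂ hV (h x) (h x)
  have hsq := (orth x y hx hy hxy).2.1
  have hr : (a x x / h x x) ^ 2 = c := by field_simp; linarith
  have hax : a x x ≠ 0 := by
    intro h0
    rw [h0] at hsq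
    exact mul_ne_zero hc (pow_ne_zero 2 px) (by linarith)
  have diag (v : V) : a v v = a x x / h x x * h v v := by
    -- Split `v` into its `h`-projection on `x` and an `h`-orthogonal remainder, to which `orth`
    -- applies.
    set s := h x v / h x x with hs
    have hv : v = s • x + (v - s • x) := by abel
    have hw0 : h x (v - s • x) = 0 := by
      simp only [map_sub, map_smul, smul_eq_mul, hs]; field_simp; ring
    generalize v - s • x = w at hv hw0
    have hw1 : a x w = 0 ∧ a w w = a x x / h x x * h w w := by
      by_cases h0 : w = 0
      · simp [h0]
      · obtain ⟨e₁, -, e₂⟩ := orth x w hx h0 hw0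
        refine ⟨e₁, ?_⟩
        refine mul_left_cancel₀ hax ?_
        rw [e₂, ← hr]; field_simp
    rw [hv]
    simp only [map_add, map_smul, LinearMap.add_apply, LinearMap.smul_apply, smul_eq_mul, ha w x,
      hh w x, hw1.1, hw1.2, hw0]
    field_simp
    ring
  refine ⟨_, hr, ?_⟩
  ext v w
  have h₁ := diag (v + w)
  simp only [map_add, LinearMap.add_apply] at h₁
  rw [ha w v, hh w v, diag v, diag w] at h₁
  simp only [LinearMap.smul_apply, smul_eq_mul]
  linarith

end Forms

/-! ### The ambient form -/

section AmbientForm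

variable {n : ℕ} {ε : ℝ}

lemma ambientForm_apply (v w : Ambient n) :
    ambientForm ε v w = ε * (v 0 * w 0) + ∑ i : Fin (n + 1), v i.succ * w i.succ := rfl

lemma ambientForm_symm (v w : Ambient n) : ambientForm ε v w = ambientForm ε w v := by
  simp only [ambientForm_apply, mul_comm]

lemma eq_zero_of_ambientForm_eq_zero (hε : ε ≠ 0) {v : Ambient n}
    (hv : ∀ w, ambientForm ε v w = 0) : v = 0 := by
  ext i
  have h := hv (EuclideanSpace.single i 1)
  refine Fin.cases (fun h => ?_) (fun j h => ?_) i h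
  · simpa [ambientForm_apply, hε] using h
  · simpa [ambientForm_apply, Pi.single_apply] using h

lemma ambientForm_verticalVector (w : Ambient n) :
    ambientForm ε (verticalVector n) w = w (Fin.last (n + 1)) := by
  simp [ambientForm_apply, verticalVector, ← Fin.succ_last]

lemma ambientForm_outwardNormal (p v : Ambient n) :
    ambientForm ε (outwardNormal p) v =
      ambientForm ε p v - p (Fin.last (n + 1)) * v (Fin.last (n + 1)) := by
  rw [outwardNormal, map_sub, map_smul, LinearMap.sub_apply, LinearMap.smul_apply,
    ambientForm_verticalVector, smul_eq_mul]

lemma outwardNormal_last (p : Ambient n) : outwardNormal p (Fin.last (n + 1)) = 0 := by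
  simp [outwardNormal, verticalVector]

/-- The form induced on `𝔼^{n+2}` by the projection to the factor containing `ℚ^n_ε`. -/
def horizontalForm (n : ℕ) (ε : ℝ) : Ambient n →L[ℝ] Ambient n →L[ℝ] ℝ :=
  LinearMap.toContinuousBilinearMap (LinearMap.mk₂ ℝ
    (fun p v => ambientForm ε (outwardNormal p) v)
    (fun x x' y => by
      simp only [ambientForm_outwardNormal, map_add, LinearMap.add_apply, PiLp.add_apply]; ring)
    (fun c x y => by
      simp only [ambientForm_outwardNormal, map_smul, LinearMap.smul_apply, PiLp.smul_apply,
        smul_eq_mul]; ring)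
    (fun x y y' => by simp)
    (fun c x y => by simp))

lemma horizontalForm_apply (p v : Ambient n) :
    horizontalForm n ε p v = ambientForm ε (outwardNormal p) v := rfl

lemma horizontalForm_symm (p v : Ambient n) :
    horizontalForm n ε p v = horizontalForm n ε v p := by
  rw [horizontalForm_apply, horizontalForm_apply, ambientForm_outwardNormal,
    ambientForm_outwardNormal, ambientForm_symm, mul_comm]

lemma horizontalForm_self {p : Ambient n} (hp : p ∈ productSpace n ε) :
    horizontalForm n ε p p = ε := by
  rw [horizontalForm_apply, ambientForm_outwardNormal, ambientForm_apply, Fin.sum_univ_castSucc]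
  have h := hp.1
  simp only [Fin.succ_last, ← sq]
  linarith

lemma ambientForm_outwardNormal_self {p : Ambient n} (hp : p ∈ productSpace n ε) :
    ambientForm ε (outwardNormal p) (outwardNormal p) = ε := by
  rw [ambientForm_outwardNormal, outwardNormal_last, ambientForm_symm, mul_zero, sub_zero]
  exact horizontalForm_self hp

/-- The flat metric of `𝔼^{n+2}` as a continuous bilinear map. -/
def ambientFormL (n : ℕ) (ε : ℝ) : Ambient n →L[ℝ] Ambient n →L[ℝ] ℝ :=
  LinearMap.toContinuousBilinearMap (ambientForm ε)

lemma ambientFormL_apply (v w : Ambient n) : ambientFormL n ε v w = ambientForm ε v w := rfl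

end AmbientForm

/-! ### Maps into a level set of a quadratic form -/

section Quadric

variable {E W : Type*} [NormedAddCommGroup E] [NormedSpace ℝ E] [NormedAddCommGroup W]
  [NormedSpace ℝ W] {F : E → W} {Q : W →L[ℝ] W →L[ℝ] ℝ} {c : ℝ}

lemma apply_fderiv_eq_zero_of_quadric (hQ : ∀ v w, Q v w = Q w v) (hF : ∀ u, Q (F u) (F u) = c)
    {u : E} (hu : DifferentiableAt ℝ F u) (v : E) : Q (F u) (fderiv ℝ F u v) = 0 := by
  have h := Q.hasFDerivAt_of_bilinear hu.hasFDerivAt hu.hasFDerivAt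
  have h0 : (fun z => Q (F z) (F z)) = fun _ => c := funext hF
  rw [h0] at h
  have h1 := DFunLike.congr_fun (h.unique (hasFDerivAt_const c u)) v
  have h2 : Q (F u) (fderiv ℝ F u v) + Q (fderiv ℝ F u v) (F u) = 0 := h1
  rw [hQ (fderiv ℝ F u v)] at h2
  linarith

lemma apply_fderiv_fderiv_of_quadric (hQ : ∀ v w, Q v w = Q w v) (hF : ∀ u, Q (F u) (F u) = c)
    {u : E} (hu : ∀ᶠ z in nhds u, DifferentiableAt ℝ F z)
    (hu' : DifferentiableAt ℝ (fderiv ℝ F) u) (v w : E) :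
    Q (F u) (fderiv ℝ (fderiv ℝ F) u v w) = - Q (fderiv ℝ F u v) (fderiv ℝ F u w) := by
  have hw := hu'.hasFDerivAt.clm_apply (hasFDerivAt_const w u)
  have h := Q.hasFDerivAt_of_bilinear hu.self_of_nhds.hasFDerivAt hw
  have h0 : (fun z => Q (F z) (fderiv ℝ F z w)) =ᶠ[nhds u] fun _ => 0 :=
    hu.mono fun z hz => apply_fderiv_eq_zero_of_quadric hQ hF hz w
  have h1 := DFunLike.congr_fun (h.unique ((hasFDerivAt_const (0 : ℝ) u).congr_of_eventuallyEq h0)) v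
  simp at h1
  linarith

end Quadric

/-! ### The immersion read in a chart -/

section Manifold

variable {n : ℕ} {M : Type*} [TopologicalSpace M] [ChartedSpace (EuclideanSpace ℝ (Fin n)) M]
  [IsManifold (𝓡 n) ∞ M] {ε : ℝ} {g : Metric n M} {f : M → Ambient n}

/-- A map on `M` read in the preferred chart around `x`. -/
abbrev inChart (f : M → Ambient n) (x : M) : EuclideanSpace ℝ (Fin n) → Ambient n :=
  f ∘ (extChartAt (𝓡 n) x).symm

lemma eventually_contDiffAt_inChart (hf : ContMDiff (𝓡 n) 𝓘(ℝ, Ambient n) ∞ f) (x : M) :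
    ∀ᶠ u in nhds (extChartAt (𝓡 n) x x), ContDiffAt ℝ ∞ (inChart f x) u := by
  have h : ContDiffOn ℝ ∞ (inChart f x) (extChartAt (𝓡 n) x).target :=
    contMDiffOn_iff_contDiffOn.1 (hf.comp_contMDiffOn (contMDiffOn_extChartAt_symm x))
  filter_upwards [(isOpen_extChartAt_target x).eventually_mem (mem_extChartAt_target x)] with u hu
  exact h.contDiffAt ((isOpen_extChartAt_target x).mem_nhds hu)

lemma differential_eq_fderiv (hf : ContMDiff (𝓡 n) 𝓘(ℝ, Ambient n) ∞ f) (x : M)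
    (v : TangentSpace (𝓡 n) x) :
    differential f x v = fderiv ℝ (inChart f x) (extChartAt (𝓡 n) x x) v := by
  have h : MDifferentiableAt (𝓡 n) 𝓘(ℝ, Ambient n) f x := hf.mdifferentiableAt (by simp)
  -- The model has no boundary, so the derivative within its range is the full derivative.
  have h' : fderivWithin ℝ (writtenInExtChartAt (𝓡 n) 𝓘(ℝ, Ambient n) x f) (Set.range (𝓡 n))
      (extChartAt (𝓡 n) x x) = fderiv ℝ (inChart f x) (extChartAt (𝓡 n) x x) := by
    simp [writtenInExtChartAt, inChart, fderivWithin_univ]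
    rfl
  exact (DFunLike.congr_fun h.mfderiv v).trans (DFunLike.congr_fun h' v)

/-- The chain rule turns the isometry condition into the hypothesis on `G` of the coordinate Gauss
equation. -/
lemma metricInChart_eq (hf : IsHypersurface ε g f) (x : M) :
    ∀ᶠ u in nhds (extChartAt (𝓡 n) x x), ∀ i j, metricInChart g x u i j =
      ambientFormL n ε (coordDeriv (inChart f x) i u) (coordDeriv (inChart f x) j u) := by
  filter_upwards [(isOpen_extChartAt_target x).eventually_mem (mem_extChartAt_target x)] with u hu
  have hs : MDifferentiableAt (𝓡 n) (𝓡 n) (extChartAt (𝓡 n) x).symm u :=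
    ((contMDiffOn_extChartAt_symm (n := ∞) x).contMDiffAt
      ((isOpen_extChartAt_target x).mem_nhds hu)).mdifferentiableAt (by simp)
  have hf' : MDifferentiableAt (𝓡 n) 𝓘(ℝ, Ambient n) f ((extChartAt (𝓡 n) x).symm u) :=
    hf.smooth.mdifferentiableAt (by simp)
  have hc (v : EuclideanSpace ℝ (Fin n)) : fderiv ℝ (inChart f x) u v =
      differential f ((extChartAt (𝓡 n) x).symm u)
        (mfderiv (𝓡 n) (𝓡 n) (extChartAt (𝓡 n) x).symm u v) := by
    have := mfderiv_comp u hf' hs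
    rw [← mfderiv_eq_fderiv]
    exact DFunLike.congr_fun this v
  intro i j
  rw [ambientFormL_apply, coordDeriv, coordDeriv, hc, hc, hf.isometric]
  rfl

end Manifold

/-! ### The Gauss equation of a hypersurface -/

section Hypersurface

variable {n : ℕ} {M : Type*} [TopologicalSpace M] [ChartedSpace (EuclideanSpace ℝ (Fin n)) M]
  [IsManifold (𝓡 n) ∞ M] {ε : ℝ} {g : Metric n M} {f : M → Ambient n}

lemma finrank_tangentSpace (x : M) : Module.finrank ℝ (TangentSpace (𝓡 n) x) = n :=
  finrank_euclideanSpace_fin (𝕜 := ℝ) (n := n)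

instance finiteDimensional_tangentSpace (x : M) :
    FiniteDimensional ℝ (TangentSpace (𝓡 n) x) :=
  inferInstanceAs (FiniteDimensional ℝ (EuclideanSpace ℝ (Fin n)))

lemma inChart_self (x : M) : inChart f x (extChartAt (𝓡 n) x x) = f x := by simp [inChart]

lemma secondFundamentalForm_apply (x : M) (η : Ambient n) (v w : TangentSpace (𝓡 n) x) :
    secondFundamentalForm ε f x η v w = ambientForm ε η (secondDerivative f x v w) := rfl

lemma secondFundamentalForm_symm (hf : IsHypersurface ε g f) (x : M) (η : Ambient n)
    (v w : TangentSpace (𝓡 n) x) :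
    secondFundamentalForm ε f x η v w = secondFundamentalForm ε f x η w v := by
  rw [secondFundamentalForm_apply, secondFundamentalForm_apply, secondDerivative,
    coordDeriv₂_symm (eventually_contDiffAt_inChart hf.smooth x).self_of_nhds]
  rfl

lemma inner_tangentComponent (x : M) (w : TangentSpace (𝓡 n) x) :
    g.inner x (tangentComponent ε g f x) w = differential f x w (Fin.last (n + 1)) := by
  rw [tangentComponent, inner_sharp]
  exact ambientForm_verticalVector _

lemma ambientForm_outwardNormal_differential (hf : IsHypersurface ε g f) (x : M)
    (v : TangentSpace (𝓡 n) x) :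
    ambientForm ε (outwardNormal (f x)) (differential f x v) = 0 := by
  -- The quadric equation holds for every `u`, even outside the chart's target, because the inverse
  -- chart always lands in `M`.
  have h := apply_fderiv_eq_zero_of_quadric (F := inChart f x) horizontalForm_symm
    (fun u => horizontalForm_self (hf.mem _))
    ((eventually_contDiffAt_inChart hf.smooth x).self_of_nhds.differentiableAt (by simp)) v
  rwa [inChart_self, ← differential_eq_fderiv hf.smooth, horizontalForm_apply] at h

/-- The second derivative of the quadric equation gives minus the horizontal form of the two
differentials. That form is the ambient one minus the product of the last coordinates, and `⟨T,·⟩`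
is the last coordinate of the differential. -/
lemma secondFundamentalForm_outwardNormal (hf : IsHypersurface ε g f) (x : M)
    (v w : TangentSpace (𝓡 n) x) :
    secondFundamentalForm ε f x (outwardNormal (f x)) v w =
      -(g.inner x v w - g.inner x (tangentComponent ε g f x) v *
        g.inner x (tangentComponent ε g f x) w) := by
  have hF := eventually_contDiffAt_inChart hf.smooth x
  have h := apply_fderiv_fderiv_of_quadric (F := inChart f x) horizontalForm_symm
    (fun u => horizontalForm_self (hf.mem _))
    (hF.mono fun u hu => hu.differentiableAt (by simp))
    ((contDiffAt_fderiv hF.self_of_nhds).differentiableAt (by simp)) v w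
  rw [inChart_self, ← differential_eq_fderiv hf.smooth, ← differential_eq_fderiv hf.smooth,
    horizontalForm_apply, horizontalForm_apply, ambientForm_outwardNormal (differential f x v),
    hf.isometric] at h
  rw [inner_tangentComponent, inner_tangentComponent]
  exact h

/-- A vector of `𝔼^{n+2}` orthogonal to the hypersurface is a combination of the two normals. -/
lemma eq_of_normal (hε : ε * ε = 1) (hf : IsHypersurface ε g f) {x : M} {N : Ambient n}
    (hN : IsUnitNormal ε f x N) {w : Ambient n}
    (hw : ∀ v, ambientForm ε w (differential f x v) = 0) :
    w = ambientForm ε w N • N +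
      (ε * ambientForm ε w (outwardNormal (f x))) • outwardNormal (f x) := by
  have hε0 : ε ≠ 0 := by rintro rfl; simp at hε
  set ξ := outwardNormal (f x) with hξ
  have hξξ : ambientForm ε ξ ξ = ε := ambientForm_outwardNormal_self (hf.mem x)
  have hξd (v : TangentSpace (𝓡 n) x) : ambientForm ε ξ (differential f x v) = 0 :=
    ambientForm_outwardNormal_differential hf x v
  have hNξ := hN.tangent
  rw [← hξ] at hNξ
  have hξN : ambientForm ε ξ N = 0 := by rw [ambientForm_symm, hNξ]
  -- The tangent space, `N` and `ξ` together span `𝔼^{n+2}`: injectivity comes from pairing with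
  -- `N`, with `ξ` and with tangent vectors, surjectivity from counting dimensions. By nondegeneracy
  -- the claim need only be tested on this image.
  let Ψ : (TangentSpace (𝓡 n) x × ℝ × ℝ) →ₗ[ℝ] Ambient n :=
    (differential f x).coprod
      ((LinearMap.toSpanSingleton ℝ _ N).coprod (LinearMap.toSpanSingleton ℝ _ ξ))
  have hΨ (p) : Ψ p = differential f x p.1 + (p.2.1 • N + p.2.2 • ξ) := by simp [Ψ]
  have hinj : Function.Injective Ψ := by
    rw [← LinearMap.ker_eq_bot, LinearMap.ker_eq_bot']
    rintro ⟨v, s, t⟩ hv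
    rw [hΨ] at hv
    have hs := congrArg (ambientForm ε N) hv
    have ht := congrArg (ambientForm ε ξ) hv
    simp only [map_add, map_smul, hN.normal, hN.unit, hNξ, hξd, hξN, hξξ, smul_eq_mul, map_zero,
      mul_zero, add_zero, zero_add, mul_one, mul_eq_zero, hε0, or_false] at hs ht
    subst hs ht
    have hv' : differential f x v = 0 := by simpa using hv
    have hvv : g.inner x v v = 0 := by rw [← hf.isometric, hv']; simp
    have : v = 0 := by
      by_contra h
      exact (g.pos x v h).ne' hvv
    simp [this]
  have hsurj : Function.Surjective Ψ :=
    (LinearMap.injective_iff_surjective_of_finrank_eq_finrank (by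
      simp [finrank_tangentSpace])).1 hinj
  rw [← sub_eq_zero]
  refine eq_zero_of_ambientForm_eq_zero hε0 fun y => ?_
  obtain ⟨p, rfl⟩ := hsurj y
  rw [hΨ]
  simp only [map_add, map_sub, map_smul, LinearMap.add_apply, LinearMap.sub_apply,
    LinearMap.smul_apply, smul_eq_mul, hw, hN.normal, hN.unit, hNξ, hξN, hξξ, hξd]
  -- The coefficient of `ξ` carries the factor `ε` because `⟨ξ,ξ⟩ = ε` is its own inverse.
  linear_combination (-p.2.2 * ambientForm ε w ξ) * hε

lemma tangent_expand {x : M} (v : TangentSpace (𝓡 n) x) :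
    v = ∑ i, components x v i •
      (show TangentSpace (𝓡 n) x from EuclideanSpace.single i (1 : ℝ)) := by
  have h := (EuclideanSpace.basisFun (Fin n) ℝ).sum_repr (show EuclideanSpace ℝ (Fin n) from v)
  simp only [EuclideanSpace.basisFun_apply] at h
  exact h.symm

lemma sum_components {x : M} (φ : Module.Dual ℝ (TangentSpace (𝓡 n) x))
    (v : TangentSpace (𝓡 n) x) :
    ∑ i, components x v i *
      φ (show TangentSpace (𝓡 n) x from EuclideanSpace.single i (1 : ℝ)) = φ v := by
  conv_rhs => rw [tangent_expand v, map_sum]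
  exact Finset.sum_congr rfl fun i _ => by rw [map_smul, smul_eq_mul]

lemma sum_components₂ {x : M} (a : TangentSpace (𝓡 n) x →ₗ[ℝ] Module.Dual ℝ (TangentSpace (𝓡 n) x))
    (v w : TangentSpace (𝓡 n) x) :
    ∑ i, ∑ j, components x v i * components x w j *
      a (show TangentSpace (𝓡 n) x from EuclideanSpace.single i (1 : ℝ))
        (show TangentSpace (𝓡 n) x from EuclideanSpace.single j (1 : ℝ)) = a v w := by
  simp only [mul_assoc, ← Finset.mul_sum, sum_components]
  exact sum_components (a.flip w) v

/-- The components of the metric at the centre of the preferred chart. -/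
lemma metricInChart_self (hf : IsHypersurface ε g f) (x : M) (i j : Fin n) :
    metricInChart g x (extChartAt (𝓡 n) x x) i j =
      g.inner x (show TangentSpace (𝓡 n) x from EuclideanSpace.single i (1 : ℝ))
        (show TangentSpace (𝓡 n) x from EuclideanSpace.single j (1 : ℝ)) := by
  rw [(metricInChart_eq hf x).self_of_nhds, ← hf.isometric, differential_eq_fderiv hf.smooth,
    differential_eq_fderiv hf.smooth]
  rfl

lemma sum_metricInChart (hf : IsHypersurface ε g f) (x : M) (v w : TangentSpace (𝓡 n) x) :
    ∑ i, ∑ j, components x v i * components x w j *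
      metricInChart g x (extChartAt (𝓡 n) x x) i j = g.inner x v w := by
  simp only [metricInChart_self hf]
  exact sum_components₂ (metricForm g x) v w

/-- A kernel vector of the matrix would be a nonzero tangent vector of length zero. -/
lemma det_metricInChart_ne_zero (hf : IsHypersurface ε g f) (x : M) :
    (metricInChart g x (extChartAt (𝓡 n) x x)).det ≠ 0 := by
  intro hdet
  obtain ⟨c, hc0, hc⟩ := Matrix.exists_mulVec_eq_zero_iff.2 hdet
  let v : TangentSpace (𝓡 n) x := (WithLp.toLp 2 c : EuclideanSpace ℝ (Fin n))
  have hv0 : v ≠ 0 := fun h => hc0 (congrArg WithLp.ofLp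
    (show (WithLp.toLp 2 c : EuclideanSpace ℝ (Fin n)) = 0 from h))
  refine (g.pos x v hv0).ne' ?_
  rw [← sum_metricInChart hf x v v]
  refine Finset.sum_eq_zero fun i _ => ?_
  have h := congrFun hc i
  simp only [Matrix.mulVec, dotProduct, Pi.zero_apply] at h
  calc _ = c i * ∑ j, metricInChart g x (extChartAt (𝓡 n) x x) i j * c j := by
        rw [Finset.mul_sum]
        exact Finset.sum_congr rfl fun j _ => by
          change c i * c j * _ = _
          ring
    _ = 0 := by rw [h, mul_zero]

/-- The Gauss equation in the preferred chart, in terms of the second fundamental form. -/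
lemma gauss_equation_components (hε : ε * ε = 1) (hf : IsHypersurface ε g f) {x : M} {N : Ambient n}
    (hN : IsUnitNormal ε f x N) (i j k m : Fin n) :
    ∑ l, riemannComponent (metricInChart g x) l i j k (extChartAt (𝓡 n) x x) *
        metricInChart g x (extChartAt (𝓡 n) x x) l m =
      let a (η : Ambient n) (p q : Fin n) := secondFundamentalForm ε f x η
        (show TangentSpace (𝓡 n) x from EuclideanSpace.single p (1 : ℝ))
        (show TangentSpace (𝓡 n) x from EuclideanSpace.single q (1 : ℝ))
      a N j k * a N i m - a N i k * a N j m +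
        ε * (a (outwardNormal (f x)) j k * a (outwardNormal (f x)) i m -
          a (outwardNormal (f x)) i k * a (outwardNormal (f x)) j m) := by
  have hF := eventually_contDiffAt_inChart hf.smooth x
  have hG := metricInChart_eq hf x
  have hsymm (v w : Ambient n) : ambientFormL n ε v w = ambientFormL n ε w v :=
    ambientForm_symm v w
  have hdet := det_metricInChart_ne_zero hf x
  rw [gauss_equation_coord hsymm hF hG hdet]
  set u := extChartAt (𝓡 n) x x with hu
  have hd (v : EuclideanSpace ℝ (Fin n)) :
      fderiv ℝ (inChart f x) u v = differential f x v :=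
    (differential_eq_fderiv hf.smooth x v).symm
  have key (j k i m : Fin n) :
      ambientFormL n ε (coordDeriv₂ (inChart f x) j k u) (coordDeriv₂ (inChart f x) i m u)
        - ∑ l, christoffel (metricInChart g x) l j k u *
          ambientFormL n ε (coordDeriv (inChart f x) l u) (coordDeriv₂ (inChart f x) i m u) =
      ambientForm ε N (coordDeriv₂ (inChart f x) j k u) *
        ambientForm ε N (coordDeriv₂ (inChart f x) i m u) +
      ε * (ambientForm ε (outwardNormal (f x)) (coordDeriv₂ (inChart f x) j k u) *
        ambientForm ε (outwardNormal (f x)) (coordDeriv₂ (inChart f x) i m u)) := by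
    -- The Christoffel symbols give the tangential part `t` of the second derivative, so `p` is the
    -- normal vector `α(∂ⱼ, ∂ₖ)` and expands in `N` and `ξ`.
    set t := ∑ l, christoffel (metricInChart g x) l j k u • coordDeriv (inChart f x) l u with ht
    set p := coordDeriv₂ (inChart f x) j k u - t with hp
    have hpd (v : TangentSpace (𝓡 n) x) : ambientForm ε p (differential f x v) = 0 := by
      refine (sum_components ((ambientForm ε p).comp (differential f x)) v).symm.trans
        (Finset.sum_eq_zero fun q _ => ?_)
      have h := sum_christoffel_mul hsymm hF.self_of_nhds hG hdet j k q
      simp only [hG.self_of_nhds, ambientFormL_apply] at h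
      have h' : ambientForm ε p (differential f x
          (show TangentSpace (𝓡 n) x from EuclideanSpace.single q (1 : ℝ))) = 0 := by
        rw [differential_eq_fderiv hf.smooth, hp, ht, map_sub, LinearMap.sub_apply, map_sum,
          LinearMap.sum_apply]
        simp only [map_smul, LinearMap.smul_apply, smul_eq_mul]
        exact sub_eq_zero.2 h.symm
      exact mul_eq_zero_of_right _ h'
    have ht0 (η : Ambient n) (hη : ∀ v, ambientForm ε η (differential f x v) = 0) :
        ambientForm ε p η = ambientForm ε η (coordDeriv₂ (inChart f x) j k u) := by
      rw [ambientForm_symm, hp, map_sub, ht, map_sum, sub_eq_self]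
      refine Finset.sum_eq_zero fun l _ => ?_
      rw [map_smul, coordDeriv, hd]
      exact mul_eq_zero_of_right _ (hη _)
    have hexp := eq_of_normal hε hf hN hpd
    rw [ht0 N hN.normal, ht0 _ (ambientForm_outwardNormal_differential hf x)] at hexp
    have hres := congrArg (fun y => ambientForm ε y (coordDeriv₂ (inChart f x) i m u)) hexp
    simp only [map_add, map_smul, LinearMap.add_apply, LinearMap.smul_apply, smul_eq_mul] at hres
    rw [hp, ht, map_sub, LinearMap.sub_apply, map_sum, LinearMap.sum_apply] at hres
    simp only [map_smul, LinearMap.smul_apply, smul_eq_mul] at hres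
    simp only [ambientFormL_apply]
    rw [hres]
    ring
  rw [key, key]
  change _ = ambientForm ε N (coordDeriv₂ (inChart f x) j k u) *
        ambientForm ε N (coordDeriv₂ (inChart f x) i m u) -
      ambientForm ε N (coordDeriv₂ (inChart f x) i k u) *
        ambientForm ε N (coordDeriv₂ (inChart f x) j m u) +
      ε * (ambientForm ε (outwardNormal (f x)) (coordDeriv₂ (inChart f x) j k u) *
        ambientForm ε (outwardNormal (f x)) (coordDeriv₂ (inChart f x) i m u) -
        ambientForm ε (outwardNormal (f x)) (coordDeriv₂ (inChart f x) i k u) *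
        ambientForm ε (outwardNormal (f x)) (coordDeriv₂ (inChart f x) j m u))
  ring

lemma sum_components₄ {x : M}
    (a b : TangentSpace (𝓡 n) x →ₗ[ℝ] Module.Dual ℝ (TangentSpace (𝓡 n) x))
    (v w y z : TangentSpace (𝓡 n) x) :
    ∑ i, ∑ j, ∑ k, ∑ m, components x v i * components x w j * components x y k * components x z m *
      (a (show TangentSpace (𝓡 n) x from EuclideanSpace.single j (1 : ℝ))
        (show TangentSpace (𝓡 n) x from EuclideanSpace.single k (1 : ℝ)) *
      b (show TangentSpace (𝓡 n) x from EuclideanSpace.single i (1 : ℝ))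
        (show TangentSpace (𝓡 n) x from EuclideanSpace.single m (1 : ℝ))) = a w y * b v z := by
  rw [← sum_components₂ a w y, ← sum_components₂ b v z]
  simp only [Finset.sum_mul]
  simp only [Finset.mul_sum]
  conv_rhs => rw [Finset.sum_comm_cycle]
  refine Finset.sum_congr rfl fun i _ => Finset.sum_congr rfl fun j _ =>
    Finset.sum_congr rfl fun k _ => Finset.sum_congr rfl fun m _ => ?_
  ring

lemma sum_components₄_swap {x : M}
    (a b : TangentSpace (𝓡 n) x →ₗ[ℝ] Module.Dual ℝ (TangentSpace (𝓡 n) x))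
    (v w y z : TangentSpace (𝓡 n) x) :
    ∑ i, ∑ j, ∑ k, ∑ m, components x v i * components x w j * components x y k * components x z m *
      (a (show TangentSpace (𝓡 n) x from EuclideanSpace.single i (1 : ℝ))
        (show TangentSpace (𝓡 n) x from EuclideanSpace.single k (1 : ℝ)) *
      b (show TangentSpace (𝓡 n) x from EuclideanSpace.single j (1 : ℝ))
        (show TangentSpace (𝓡 n) x from EuclideanSpace.single m (1 : ℝ))) = a v y * b w z := by
  rw [← sum_components₄ a b w v y z, Finset.sum_comm]
  simp only [mul_comm (components x w _)]

lemma sum_mul_contraction {ι : Type*} [Fintype ι] (R : ι → ι → ι → ι → ℝ) (G : ι → ι → ℝ)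
    (X Y Z W : ι → ℝ) :
    ∑ l, ∑ m, (∑ i, ∑ j, ∑ k, X i * Y j * Z k * R l i j k) * W m * G l m =
      ∑ i, ∑ j, ∑ k, ∑ m, X i * Y j * Z k * W m * ∑ l, R l i j k * G l m := by
  simp only [Finset.sum_mul, Finset.mul_sum]
  rw [Finset.sum_comm_cycle]
  refine Finset.sum_congr rfl fun i _ => ?_
  rw [Finset.sum_comm_cycle]
  refine Finset.sum_congr rfl fun j _ => ?_
  rw [Finset.sum_comm_cycle]
  refine Finset.sum_congr rfl fun k _ => ?_
  rw [Finset.sum_comm]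
  refine Finset.sum_congr rfl fun m _ => Finset.sum_congr rfl fun l _ => ?_
  ring

/-- The Gauss equation of a hypersurface of `ℚ^n_ε × ℝ`. -/
theorem gauss_equation (hε : ε * ε = 1) (hf : IsHypersurface ε g f) {x : M} {N : Ambient n}
    (hN : IsUnitNormal ε f x N) (X Y Z W : TangentSpace (𝓡 n) x) :
    g.inner x (curvature g x X Y Z) W =
      secondFundamentalForm ε f x N Y Z * secondFundamentalForm ε f x N X W -
        secondFundamentalForm ε f x N X Z * secondFundamentalForm ε f x N Y W +
      ε * (secondFundamentalForm ε f x (outwardNormal (f x)) Y Z *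
          secondFundamentalForm ε f x (outwardNormal (f x)) X W -
        secondFundamentalForm ε f x (outwardNormal (f x)) X Z *
          secondFundamentalForm ε f x (outwardNormal (f x)) Y W) := by
  have h₁ : g.inner x (curvature g x X Y Z) W = ∑ i, ∑ j, ∑ k, ∑ m,
      components x X i * components x Y j * components x Z k * components x W m *
      ∑ l, riemannComponent (metricInChart g x) l i j k (extChartAt (𝓡 n) x x) *
        metricInChart g x (extChartAt (𝓡 n) x x) l m := by
    rw [← sum_metricInChart hf]
    exact sum_mul_contraction _ _ _ _ _ _
  rw [h₁]
  simp only [gauss_equation_components hε hf hN, mul_add, mul_sub, mul_left_comm _ ε,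
    Finset.sum_add_distrib, Finset.sum_sub_distrib, ← Finset.mul_sum]
  simp only [sum_components₄, sum_components₄_swap]

lemma inner_curvature_eq_zero (hg : IsFlat g) (x : M) (X Y : TangentSpace (𝓡 n) x)
    (hXY : LinearIndependent ℝ ![X, Y]) : g.inner x (curvature g x X Y Y) X = 0 := by
  -- Strict Cauchy–Schwarz: the denominator is nonzero, so a vanishing quotient really means a
  -- vanishing numerator.
  have hpos : 0 < g.inner x X X * g.inner x Y Y - g.inner x X Y ^ 2 := by
    have hX : 0 < g.inner x X X := g.pos x X (hXY.ne_zero 0)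
    set s := g.inner x X Y / g.inner x X X with hs
    have hne : Y - s • X ≠ 0 := by
      intro h
      have := LinearIndependent.pair_iff.1 hXY (-s) 1 (by rw [← h]; module)
      exact one_ne_zero this.2
    have h := mul_pos hX (g.pos x _ hne)
    have e : g.inner x X X * g.inner x (Y - s • X) (Y - s • X) =
        g.inner x X X * g.inner x Y Y - g.inner x X Y ^ 2 := by
      change g.inner x X X * metricForm g x (Y - s • X) (Y - s • X) = _
      simp only [map_sub, map_smul, LinearMap.sub_apply, LinearMap.smul_apply, smul_eq_mul]
      change g.inner x X X * (g.inner x Y Y - s * g.inner x X Y -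
        s * (g.inner x Y X - s * g.inner x X X)) = _
      rw [g.symm x Y X, hs]
      field_simp
      ring
    exact e ▸ h
  have h := hg x X Y hXY
  rw [sectionalCurvature, div_eq_zero_iff] at h
  exact h.resolve_right hpos.ne'

end Hypersurface

/-! ### Flat hypersurfaces -/

section FlatHypersurface

variable {n : ℕ} {M : Type*} [TopologicalSpace M] [ChartedSpace (EuclideanSpace ℝ (Fin n)) M]
  [IsManifold (𝓡 n) ∞ M] {ε : ℝ} {g : Metric n M} {f : M → Ambient n}

lemma metricForm_apply (x : M) (v w : TangentSpace (𝓡 n) x) :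
    metricForm g x v w = g.inner x v w := rfl

lemma metricForm_symm (x : M) (v w : TangentSpace (𝓡 n) x) :
    metricForm g x v w = metricForm g x w v := g.symm x v w

lemma metricForm_pos (x : M) {v : TangentSpace (𝓡 n) x} (hv : v ≠ 0) : 0 < metricForm g x v v :=
  g.pos x v hv

lemma sharp_metricForm (x : M) (v : TangentSpace (𝓡 n) x) :
    sharp g x (metricForm g x v) = v := by
  rw [← sub_eq_zero]
  refine (metricForm_nondegenerate g x).1 _ fun w => ?_
  rw [map_sub, LinearMap.sub_apply, metricForm_apply, inner_sharp, sub_self]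

/-- The vector `w = ∂/∂t - f_*T` is normal and orthogonal to `ξ`, hence equals `νN`; compute `⟨w,w⟩`
both ways. -/
lemma inner_tangentComponent_self_add_sq (hε : ε * ε = 1) (hf : IsHypersurface ε g f) {x : M}
    {N : Ambient n} (hN : IsUnitNormal ε f x N) :
    metricForm g x (tangentComponent ε g f x) (tangentComponent ε g f x)
      + normalComponent ε N ^ 2 = 1 := by
  set T := tangentComponent ε g f x with hT
  set w := verticalVector n - differential f x T with hw
  have hTv (v : TangentSpace (𝓡 n) x) :
      ambientForm ε (verticalVector n) (differential f x v) = g.inner x T v := by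
    rw [ambientForm_verticalVector, hT, inner_tangentComponent]
  have hwd (v : TangentSpace (𝓡 n) x) : ambientForm ε w (differential f x v) = 0 := by
    rw [hw, map_sub, LinearMap.sub_apply, hTv, hf.isometric, sub_self]
  have hwN : ambientForm ε w N = normalComponent ε N := by
    rw [hw, map_sub, LinearMap.sub_apply, ambientForm_symm (differential f x T), hN.normal,
      sub_zero, normalComponent]
  have hwξ : ambientForm ε w (outwardNormal (f x)) = 0 := by
    rw [hw, map_sub, LinearMap.sub_apply, ambientForm_symm (differential f x T),
      ambientForm_outwardNormal_differential hf, ambientForm_verticalVector, outwardNormal_last,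
      sub_zero]
  have h := eq_of_normal hε hf hN hwd
  rw [hwN, hwξ, mul_zero, zero_smul, add_zero] at h
  have h₁ : ambientForm ε w w = normalComponent ε N ^ 2 := by
    conv_lhs => rw [h]
    simp [hN.unit, sq]
  have h₂ : ambientForm ε w w = 1 - g.inner x T T := by
    have h₃ : ambientForm ε w w = ambientForm ε w (verticalVector n) := by
      conv_lhs => rw [hw, map_sub, ← hw, hwd, sub_zero]
    rw [h₃, hw, map_sub, LinearMap.sub_apply, ambientForm_symm (differential f x T), hTv,
      ambientForm_verticalVector]
    simp [verticalVector]
  rw [metricForm_apply]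
  linarith

/-- The Gauss equation of a flat hypersurface: the exterior squares of `A_N` and `A_ξ` are
proportional. -/
lemma wedge_secondFundamentalForm (hε : ε * ε = 1) (hg : IsFlat g) (hf : IsHypersurface ε g f)
    {x : M} {N : Ambient n} (hN : IsUnitNormal ε f x N) (v w y z : TangentSpace (𝓡 n) x) :
    secondFundamentalForm ε f x N v z * secondFundamentalForm ε f x N w y -
        secondFundamentalForm ε f x N v y * secondFundamentalForm ε f x N w z =
      -ε * ((-secondFundamentalForm ε f x (outwardNormal (f x))) v z *
          (-secondFundamentalForm ε f x (outwardNormal (f x))) w y -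
        (-secondFundamentalForm ε f x (outwardNormal (f x))) v y *
          (-secondFundamentalForm ε f x (outwardNormal (f x))) w z) := by
  have hs := secondFundamentalForm_symm hf x
  -- Sectional curvatures give only the diagonal identity, and only on independent pairs; on
  -- dependent pairs both sides vanish. The sign of `A_ξ` does not affect its exterior square.
  refine wedge_eq_of_diagonal (hs N) (fun v w => ?_) (fun v w => ?_) v w y z
  · simp only [LinearMap.neg_apply, hs _ v w]
  · simp only [LinearMap.neg_apply]
    by_cases hvw : LinearIndependent ℝ ![v, w]
    · have h := gauss_equation hε hf hN v w w v
      rw [inner_curvature_eq_zero hg x v w hvw, hs _ w v, hs _ w v] at h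
      linear_combination -h
    · by_cases hv : v = 0
      · simp [hv]
      · rw [LinearIndependent.pair_iff' hv] at hvw
        push Not at hvw
        obtain ⟨c, rfl⟩ := hvw
        simp only [map_smul, LinearMap.smul_apply, smul_eq_mul]
        ring

lemma isPrincipalDirection_of_smul {x : M} {N : Ambient n} {v : TangentSpace (𝓡 n) x} (hv : v ≠ 0)
    {μ : ℝ} (h : secondFundamentalForm ε f x N v = μ • metricForm g x v) :
    IsPrincipalDirection ε g f x N v := by
  refine ⟨μ, Module.End.hasEigenvector_iff.2 ⟨Module.End.mem_eigenspace_iff.2 ?_, hv⟩⟩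
  rw [shapeOperator, LinearMap.comp_apply, h, map_smul, sharp_metricForm]

lemma IsUnitNormal.neg {x : M} {N : Ambient n} (hN : IsUnitNormal ε f x N) :
    IsUnitNormal ε f x (-N) where
  tangent := by simp [hN.tangent]
  normal v := by simp [hN.normal]
  unit := by simp [hN.unit]

lemma secondFundamentalForm_neg (x : M) (η : Ambient n) :
    secondFundamentalForm ε f x (-η) = -secondFundamentalForm ε f x η := by
  ext v w
  simp [secondFundamentalForm_apply]

/-- If `ν ≠ 0`, then `A_N` is a multiple of `A_ξ`. -/
lemma secondFundamentalForm_eq_smul (hn : 3 ≤ n) (hε : ε * ε = 1) (hg : IsFlat g)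
    (hf : IsHypersurface ε g f) {x : M} {N : Ambient n} (hN : IsUnitNormal ε f x N)
    (hν : normalComponent ε N ≠ 0) :
    ∃ r : ℝ, r ^ 2 = -ε ∧ secondFundamentalForm ε f x N =
      r • -secondFundamentalForm ε f x (outwardNormal (f x)) := by
  have hε0 : -ε ≠ 0 := by
    rw [neg_ne_zero]; rintro rfl; simp at hε
  have hs := secondFundamentalForm_symm hf x
  refine exists_eq_smul_of_wedge_eq (by rwa [finrank_tangentSpace]) hε0 (hs N)
    (fun v w => ?_) (fun v hv => ?_) (wedge_secondFundamentalForm hε hg hf hN)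
  · simp only [LinearMap.neg_apply, hs _ v w]
  · simp only [LinearMap.neg_apply, secondFundamentalForm_outwardNormal hf, neg_neg]
    have h1 := inner_tangentComponent_self_add_sq hε hf hN
    set T := tangentComponent ε g f x
    simp only [← metricForm_apply (g := g)]
    have hvv := metricForm_pos (g := g) x hv
    set s := metricForm g x T v with hsdef
    -- Using `|T|² = 1 - ν²`, this reads `|v|² - s² ≥ ν² s²`, which is positive unless `s = 0`; in
    -- that case `|v|²` is.
    have hnn : 0 ≤ metricForm g x (v - s • T) (v - s • T) := by
      by_cases h : v - s • T = 0
      · simp [h]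
      · exact (metricForm_pos x h).le
    simp only [map_sub, map_smul, LinearMap.sub_apply, LinearMap.smul_apply, smul_eq_mul,
      metricForm_symm x v T, ← hsdef] at hnn
    by_cases hs0 : s = 0
    · rw [hs0]; linarith
    · have := mul_pos (sq_pos_of_ne_zero hs0) (sq_pos_of_ne_zero hν)
      nlinarith

/-- If `ν = 0`, then `T` is in the kernel of `A_N`. -/
lemma secondFundamentalForm_tangentComponent_eq_zero (hn : 3 ≤ n) (hε : ε * ε = 1) (hg : IsFlat g)
    (hf : IsHypersurface ε g f) {x : M} {N : Ambient n} (hN : IsUnitNormal ε f x N)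
    (hν : normalComponent ε N = 0) :
    secondFundamentalForm ε f x N (tangentComponent ε g f x) = 0 := by
  have hε0 : -ε ≠ 0 := by
    rw [neg_ne_zero]; rintro rfl; simp at hε
  have h1 := inner_tangentComponent_self_add_sq hε hf hN
  rw [hν, zero_pow two_ne_zero, add_zero] at h1
  have hn' : 3 ≤ Module.finrank ℝ (TangentSpace (𝓡 n) x) := by rwa [finrank_tangentSpace]
  -- Orthogonal `v`, `w` in the complement of `T` make the exterior square of `h` equal to
  -- `|v|²|w|²`. Only one condition is imposed on `v`, hence the repeated functional.
  obtain ⟨v, hv, hTv, -⟩ := exists_ne_zero_apply_eq_zero₂ hn'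
    (metricForm g x (tangentComponent ε g f x)) (metricForm g x (tangentComponent ε g f x))
  obtain ⟨w, hw, hTw, hvw⟩ := exists_ne_zero_apply_eq_zero₂ hn'
    (metricForm g x (tangentComponent ε g f x)) (metricForm g x v)
  refine apply_eq_zero_of_wedge_eq (x := v) (y := w) hε0
    (wedge_secondFundamentalForm hε hg hf hN) ?_ ?_
  · ext y
    simp only [LinearMap.neg_apply, secondFundamentalForm_outwardNormal hf,
      ← metricForm_apply (g := g), h1, LinearMap.zero_apply]
    ring
  · simp only [LinearMap.neg_apply, secondFundamentalForm_outwardNormal hf,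
      ← metricForm_apply (g := g), hTv, hTw, hvw, metricForm_symm x w v]
    simpa using ⟨(metricForm_pos x hv).ne', (metricForm_pos x hw).ne'⟩

end FlatHypersurface

end ProductHypersurface

end

/-! ### The cases `ν = 0` and `ν ≠ 0` -/

open ProductHypersurface in
theorem lemma3p6 {n : ℕ} (hn : 3 ≤ n) {ε : ℝ} (hε : ε = 1 ∨ ε = -1)
    {M : Type*} [TopologicalSpace M] [ChartedSpace (EuclideanSpace ℝ (Fin n)) M]
    [IsManifold (𝓡 n) ∞ M] (g : Metric n M) (hg : IsFlat g)
    (f : M → Ambient n) (hf : IsHypersurface ε g f)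
    (x : M) (hT : tangentComponent ε g f x ≠ 0)
    (N : Ambient n) (hN : IsUnitNormal ε f x N) :
    (ε = 1 → normalComponent ε N = 0) ∧
    (ε = -1 → normalComponent ε N = 0 ∨
      ∃ N' : Ambient n, IsUnitNormal ε f x N' ∧
        shapeOperator ε g f x N' = shapeOperator ε g f x (outwardNormal (f x))) ∧
    IsPrincipalDirection ε g f x N (tangentComponent ε g f x) := by
  have hε2 : ε * ε = 1 := by rcases hε with rfl | rfl <;> norm_num
  by_cases hν : normalComponent ε N = 0
  · refine ⟨fun _ => hν, fun _ => Or.inl hν, isPrincipalDirection_of_smul (μ := 0) hT ?_⟩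
    rw [secondFundamentalForm_tangentComponent_eq_zero hn hε2 hg hf hN hν, zero_smul]
  · obtain ⟨r, hr, hA⟩ := secondFundamentalForm_eq_smul hn hε2 hg hf hN hν
    refine ⟨fun h => ?_, fun h => Or.inr ?_, ?_⟩
    · nlinarith [sq_nonneg r]
    · have hr1 : r ^ 2 = 1 := by rw [hr, h, neg_neg]
      rcases (sq_eq_sq_iff_eq_or_eq_neg.1 (by rw [hr1, one_pow]) : r = 1 ∨ r = -1) with rfl | rfl
      -- `r` is the factor relative to `-A_ξ`, so `r = 1` calls for the opposite normal.
      · refine ⟨-N, hN.neg, ?_⟩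
        have h' : secondFundamentalForm ε f x (-N) =
            secondFundamentalForm ε f x (outwardNormal (f x)) := by
          ext v w
          simp [secondFundamentalForm_neg, hA]
        rw [shapeOperator, shapeOperator, h']
      · refine ⟨N, hN, ?_⟩
        have h' : secondFundamentalForm ε f x N =
            secondFundamentalForm ε f x (outwardNormal (f x)) := by
          ext v w
          simp [hA]
        rw [shapeOperator, shapeOperator, h']
    -- The eigenvalue comes from `h(T,·) = (1 - |T|²)⟨T,·⟩`.
    · refine isPrincipalDirection_of_smul (μ := r * (1 - metricForm g x
        (tangentComponent ε g f x) (tangentComponent ε g f x))) hT ?_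
      ext w
      simp only [hA, LinearMap.smul_apply, LinearMap.neg_apply, smul_eq_mul,
        secondFundamentalForm_outwardNormal hf, ← metricForm_apply (g := g)]
      ring
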